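/- Let $(\Omega,\mathcal F,P)$ be a probability space, $\mathcal H_1,\dots,\mathcal H_p$ separable real Hilbert spaces, $X=(X^1,\dots,X^p)$ a random element of $\mathcal H_1\oplus\cdots\oplus\mathcal H_p$, and let $X$ follow a statistical graphical model with respect to an undirected graph $\mathsf G$ on $\{1,\dots,p\}$ with edge set $\mathsf E$: for all $i\ne j$, $(i,j)\notin\mathsf E$ if and only if $X^i\perp X^j\mid X^{-(i,j)}$, where $X^{-(i,j)}=(X^k:k\notin\{i,j\})$ and $\perp$ denotes (conditional) independence. Fix $i\ne j$ and put $X^{(i,j)}=(X^i,X^j)$. **Notation.** All kernels are jointly measurable and positive semidefinite. For a kernel $k$ with reproducing kernel Hilbert space (RKHS) $\mathfrak M^0_k$ and a random element $Y$ with $E\,k(Y,Y)<\infty$, and likewise $l$ and $Z$, the covariance operator $\Sigma_{YZ}:\mathfrak M_l^0\to\mathfrak M_k^0$ is defined by $\langle f,\Sigma_{YZ}g\rangle=\mathrm{cov}(f(Y),g(Z))$. The centered RKHS of $k$ for $Y$ is $\mathfrak M_k=\overline{\mathrm{ran}}(\Sigma_{YY})$; it is dense in $L_2(P_Y)$ modulo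 constants if $\{f+c:f\in\mathfrak M_k,\ c\in\mathbb R\}$ is dense in $L_2(P_Y)$, $P_Y$ being the law of $Y$. The Moore–Penrose inverse $\Sigma_{YY}^\dagger$ maps $h\in\mathrm{ran}(\Sigma_{YY})$ to the unique $g\in\overline{\mathrm{ran}}(\Sigma_{YY})$ with $\Sigma_{YY}g=h$. A kernel $k$ is universal on a set $S$ if $\mathfrak M^0_k$ is dense in $L_2(Q)$ for every probability measure $Q$ carried by $S$ with $\int k(x,x)\,dQ(x)<\infty$. **Sufficient predictor.** Let $\kappa_{(i,j)}$ and $\kappa_{-(i,j)}$ be kernels on $\mathcal H_i\oplus\mathcal H_j$ and $\bigoplus_{k\notin\{i,j\}}\mathcal H_k$ with $E\,\kappa_{(i,j)}(X^{(i,j)},X^{(i,j)})<\infty$ and $E\,\kappa_{-(i,j)}(X^{-(i,j)},X^{-(i,j)})<\infty$, whose centered RKHSs $\mathfrak M_{(i,j)}$ and $\mathfrak M_{-(i,j)}$ are dense modulo constants in $L_2(P_{X^{(i,j)}})$ and $L_2(P_{X^{-(i,j)}})$, respectively. Suppose $\mathrm{ran}(\Sigma_{X^{-(i,j)}X^{(i,j)}})\subseteq\mathrm{ran}(\Sigma_{X^{-(i,j)}X^{-(i,j)}})$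 and that the regression operator $R=\Sigma_{X^{-(i,j)}X^{-(i,j)}}^\dagger\Sigma_{X^{-(i,j)}X^{(i,j)}}$ on $\mathfrak M_{(i,j)}$ has finite rank $d=d_{ij}$. Let $f_1,\dots,f_d\in\mathfrak M_{-(i,j)}$ be f-GSIR solutions: for each $r$, $f_r$ maximizes $\langle f,\Sigma_{X^{-(i,j)}X^{(i,j)}}\Sigma_{X^{(i,j)}X^{-(i,j)}}f\rangle$ over $f\in\mathfrak M_{-(i,j)}$ subject to $\langle f,\Sigma_{X^{-(i,j)}X^{-(i,j)}}f\rangle=1$ and $\langle f,\Sigma_{X^{-(i,j)}X^{-(i,j)}}f_s\rangle=0$ for $s<r$. Put $U^{ij}=(f_1(X^{-(i,j)}),\dots,f_d(X^{-(i,j)}))\in\mathbb R^d$. **Hybrid conjoined conditional covariance operator.** Let $\kappa_i,\kappa_j,\lambda_{ij}$ be kernels on $\mathcal H_i,\mathcal H_j,\mathbb R^d$. Put $\lambda_{i,ij}=\kappa_i\times\lambda_{ij}$, $\lambda_{j,ij}=\kappa_j\times\lambda_{ij}$, $V^{i,ij}=(X^i,U^{ij})$, $V^{j,ij}=(X^j,U^{ij})$,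 let $\mathfrak N_{j,ij}$ and $\mathfrak N_{ij}$ be the centered RKHSs of $\lambda_{j,ij}$ for $V^{j,ij}$ and of $\lambda_{ij}$ for $U^{ij}$, and let $\Omega_{U^{ij}}$ be the support of $U^{ij}$. Assume: 1. $\lambda_{i,ij}$ and $\lambda_{j,ij}$ are universal on $\mathcal H_i\times\Omega_{U^{ij}}$ and $\mathcal H_j\times\Omega_{U^{ij}}$, respectively; 2. $\mathfrak N_{ij}$ is dense in $L_2(P_{U^{ij}})$ modulo constants; 3. $E\,\lambda_{i,ij}(V^{i,ij},V^{i,ij})$, $E\,\lambda_{j,ij}(V^{j,ij},V^{j,ij})$ and $E\,\lambda_{ij}(U^{ij},U^{ij})$ are finite; 4. $\mathrm{ran}(\Sigma_{U^{ij}V^{j,ij}})\subseteq\mathrm{ran}(\Sigma_{U^{ij}U^{ij}})$, so that $\Sigma_{\ddot X^i\ddot X^j|U^{ij}}=\Sigma_{V^{i,ij}V^{j,ij}}-\Sigma_{V^{i,ij}U^{ij}}\Sigma_{U^{ij}U^{ij}}^\dagger\Sigma_{U^{ij}V^{j,ij}}$ is well defined on $\mathfrak N_{j,ij}$. Then $$(i,j)\notin\mathsf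 E\iff X^i\perp X^j\mid U^{ij}\iff\Sigma_{\ddot X^i\ddot X^j|U^{ij}}=0.$$ -/

import Mathlib

open MeasureTheory ProbabilityTheory
open scoped ENNReal

noncomputable section

namespace FSGM

/-! ### Positive kernels and their reproducing kernel Hilbert spaces -/

/-- A (jointly measurable) positive kernel `D × D → ℝ`: symmetric, with
`∑ cᵢ cⱼ k(xᵢ, xⱼ) ≥ 0` for all finite families. -/
structure PosKernel (D : Type*) [MeasurableSpace D] where
  toFun : D → D → ℝ
  posSemidef' : Matrix.PosSemidef (Matrix.of toFun)
  measurable' : Measurable (fun z : D × D => toFun z.1 z.2)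

namespace PosKernel

variable {D D' : Type*} [MeasurableSpace D] [MeasurableSpace D']

instance : CoeFun (PosKernel D) (fun _ => D → D → ℝ) := ⟨PosKernel.toFun⟩

/-- The product kernel `((x, u), (y, v)) ↦ k(x, y) l(u, v)`. -/
def prod (k : PosKernel D) (l : PosKernel D') : PosKernel (D × D') where
  toFun z w := k z.1 w.1 * l z.2 w.2
  posSemidef' := by
    have h := (k.posSemidef'.submatrix (Prod.fst : D × D' → D)).hadamard
      (l.posSemidef'.submatrix (Prod.snd : D × D' → D'))
    exact h
  measurable' := by
    have h1 : Measurable (fun z : (D × D') × (D × D') => k z.1.1 z.2.1) :=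
      k.measurable'.comp (f := fun z : (D × D') × (D × D') => (z.1.1, z.2.1)) (by fun_prop)
    have h2 : Measurable (fun z : (D × D') × (D × D') => l z.1.2 z.2.2) :=
      l.measurable'.comp (f := fun z : (D × D') × (D × D') => (z.1.2, z.2.2)) (by fun_prop)
    exact h1.mul h2

/-- The kernel as a matrix with entries in `ℝ →L[ℝ] ℝ`, the format of Mathlib's `RKHS`. -/
def toMatrix (k : PosKernel D) : Matrix D D (ℝ →L[ℝ] ℝ) :=
  Matrix.of fun x y => k x y • ContinuousLinearMap.id ℝ ℝ

theorem toMatrix_posSemidef (k : PosKernel D) : k.toMatrix.PosSemidef := by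
  have hs : ∀ x y, k x y = k y x := fun x y => by
    have := k.posSemidef'.1.apply y x
    simpa using this
  have key := (RKHS.posSemidef_tfae (K := k.toMatrix)).out 0 2
  rw [key]
  refine ⟨?_, fun vv => ?_⟩
  · have h1 : star (ContinuousLinearMap.id ℝ ℝ) = ContinuousLinearMap.id ℝ ℝ :=
      star_one (ℝ →L[ℝ] ℝ)
    ext x y
    simp [h1, toMatrix, Matrix.conjTranspose_apply, hs x y]
  · have h := k.posSemidef'.2 vv
    rw [Finsupp.sum_comm] at h
    refine h.trans_eq ?_
    simp only [toMatrix, Finsupp.sum, Matrix.of_apply, RCLike.re_to_real]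
    refine Finset.sum_congr rfl fun x _ => Finset.sum_congr rfl fun y _ => ?_
    simp
    ring

instance (k : PosKernel D) : Fact k.toMatrix.PosSemidef := ⟨k.toMatrix_posSemidef⟩

/-- The reproducing kernel Hilbert space generated by `k`, a Hilbert space of functions `D → ℝ`. -/
def Space (k : PosKernel D) : Type _ := RKHS.OfKernel k.toMatrix

instance (k : PosKernel D) : NormedAddCommGroup k.Space :=
  inferInstanceAs (NormedAddCommGroup (RKHS.OfKernel k.toMatrix))

instance (k : PosKernel D) : InnerProductSpace ℝ k.Space :=
  inferInstanceAs (InnerProductSpace ℝ (RKHS.OfKernel k.toMatrix))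

instance (k : PosKernel D) : CompleteSpace k.Space :=
  inferInstanceAs (CompleteSpace (RKHS.OfKernel k.toMatrix))

instance (k : PosKernel D) : RKHS ℝ k.Space D ℝ :=
  inferInstanceAs (RKHS ℝ (RKHS.OfKernel k.toMatrix) D ℝ)

theorem kernel_space (k : PosKernel D) : RKHS.kernel k.Space = k.toMatrix :=
  RKHS.OfKernel.kernel_ofKernel

/-- The function `k(·, x)`, as a member of the RKHS. -/
def feature (k : PosKernel D) (x : D) : k.Space := RKHS.kerFun k.Space x (1 : ℝ)

theorem feature_apply (k : PosKernel D) (x y : D) : k.feature x y = k y x := by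
  refine (RKHS.kerFun_apply k.Space x (1 : ℝ) y).trans ?_
  rw [kernel_space]
  simp [toMatrix]

theorem inner_feature (k : PosKernel D) (x : D) (f : k.Space) : inner ℝ f (k.feature x) = f x := by
  simp [feature]

theorem norm_feature_sq (k : PosKernel D) (x : D) : ‖k.feature x‖ ^ 2 = k x x := by
  rw [← real_inner_self_eq_norm_sq, inner_feature, feature_apply]

theorem measurable_apply (k : PosKernel D) (f : k.Space) : Measurable (fun x => f x) := by
  let M : Submodule ℝ k.Space :=
    { carrier := {f | Measurable (fun x => f x)}
      add_mem' := fun {f g} hf hg => by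
        have : (fun x => (f + g) x) = (fun x => f x) + fun x => g x := by ext; simp
        simpa only [Set.mem_ofPred_eq, this] using Measurable.add hf hg
      zero_mem' := by
        have : (fun x => (0 : k.Space) x) = fun _ => (0 : ℝ) := by ext; simp
        simpa only [Set.mem_ofPred_eq, this] using measurable_const
      smul_mem' := fun c f hf => by
        have : (fun x => (c • f) x) = c • fun x => f x := by ext; simp
        simpa only [Set.mem_ofPred_eq, this] using Measurable.const_smul hf c }
  have hMc : IsClosed (M : Set k.Space) := by
    refine IsSeqClosed.isClosed fun u f hu hf => ?_
    refine measurable_of_tendsto_metrizable (f := fun n x => u n x) hu ?_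
    rw [tendsto_pi_nhds]
    exact fun x => ((RKHS.continuous_eval x).tendsto f).comp hf
  have hle : Submodule.span ℝ {x | ∃ a v, RKHS.kerFun k.Space a v = x} ≤ M := by
    rw [Submodule.span_le]
    rintro _ ⟨a, v, rfl⟩
    change Measurable fun x => RKHS.kerFun k.Space a v x
    have : (fun x => RKHS.kerFun k.Space a v x) = fun x => k x a * v := by
      ext x
      refine (RKHS.kerFun_apply k.Space a v x).trans ?_
      rw [kernel_space]
      simp [toMatrix]
    rw [this]
    exact (k.measurable'.comp (f := fun x => (x, a)) (by fun_prop)).mul_const v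
  have htop := RKHS.kerFun_dense k.Space
  have : f ∈ Submodule.topologicalClosure
      (Submodule.span ℝ {x | ∃ a v, RKHS.kerFun k.Space a v = x}) := by
    rw [htop]; trivial
  exact (Submodule.topologicalClosure_minimal _ hle hMc) this

end PosKernel

/-! ### Covariance operators -/

section Covariance

variable {Ω D D' : Type*} [MeasurableSpace Ω] [MeasurableSpace D] [MeasurableSpace D']

open Classical in
/-- The (cross-)covariance operator
`E[(k(·, Y) - μ_Y) ⊗ (l(·, Z) - μ_Z)]` from the RKHS of `l` to the RKHS of `k`. The expectation is
in the weak (Riesz) sense: it is the bounded operator `S` with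
`⟪f, S g⟫ = E[⟪f, k(·, Y) - μ_Y⟫ ⟪l(·, Z) - μ_Z, g⟫] = cov(f(Y), g(Z))`. It exists under the moment
conditions of `inner_crossCov`; otherwise the value is `0`. -/
def crossCov (P : Measure Ω) (k : PosKernel D) (l : PosKernel D') (Y : Ω → D) (Z : Ω → D') :
    l.Space →L[ℝ] k.Space :=
  if h : ∃ S : l.Space →L[ℝ] k.Space, ∀ (f : k.Space) (g : l.Space),
      inner ℝ f (S g) = cov[fun ω => f (Y ω), fun ω => g (Z ω); P]
  then h.choose else 0

theorem memLp_apply {P : Measure Ω} {k : PosKernel D} {Y : Ω → D} (hY : Measurable Y)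
    (hk : Integrable (fun ω => k (Y ω) (Y ω)) P) (f : k.Space) :
    MemLp (fun ω => f (Y ω)) 2 P := by
  have hm : Measurable fun ω => f (Y ω) := (k.measurable_apply f).comp hY
  rw [memLp_two_iff_integrable_sq hm.aestronglyMeasurable]
  refine Integrable.mono' (hk.const_mul (‖f‖ ^ 2)) (hm.pow_const 2).aestronglyMeasurable
    (Filter.Eventually.of_forall fun ω => ?_)
  rw [Real.norm_eq_abs, abs_of_nonneg (sq_nonneg _), ← k.inner_feature, ← k.norm_feature_sq,
    ← mul_pow, sq_le_sq, abs_of_nonneg (by positivity : 0 ≤ ‖f‖ * ‖k.feature (Y ω)‖)]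
  exact abs_real_inner_le_norm _ _

theorem variance_apply_le {P : Measure Ω} [IsProbabilityMeasure P] {k : PosKernel D} {Y : Ω → D}
    (hY : Measurable Y) (hk : Integrable (fun ω => k (Y ω) (Y ω)) P) (f : k.Space) :
    Var[fun ω => f (Y ω); P] ≤ ‖f‖ ^ 2 * ∫ ω, k (Y ω) (Y ω) ∂P := by
  have hL := memLp_apply hY hk f
  refine (variance_le_expectation_sq hL.1).trans ?_
  rw [← integral_const_mul]
  refine integral_mono hL.integrable_sq (hk.const_mul _) fun ω => ?_
  simp only [Pi.pow_apply]
  rw [← k.inner_feature, ← k.norm_feature_sq,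
    ← mul_pow, sq_le_sq, abs_of_nonneg (by positivity : 0 ≤ ‖f‖ * ‖k.feature (Y ω)‖)]
  exact abs_real_inner_le_norm _ _

theorem abs_cov_le {P : Measure Ω} [IsProbabilityMeasure P] {A B : Ω → ℝ} (hA : MemLp A 2 P)
    (hB : MemLp B 2 P) : |cov[A, B; P]| ≤ √(Var[A; P]) * √(Var[B; P]) := by
  have key : ∀ t : ℝ, 0 ≤ Var[A; P] * (t * t) + (2 * cov[A, B; P]) * t + Var[B; P] := fun t => by
    have h := variance_nonneg (t • A + B) P
    rw [variance_add (hA.const_smul t) hB, variance_smul, covariance_smul_left] at h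
    linarith
  have h := discrim_le_zero key
  rw [← Real.sqrt_mul (variance_nonneg _ _)]
  refine Real.abs_le_sqrt ?_
  rw [discrim] at h
  linarith

/-- The defining property of the cross-covariance operator. -/
theorem inner_crossCov {P : Measure Ω} [IsProbabilityMeasure P] {k : PosKernel D}
    {l : PosKernel D'} {Y : Ω → D} {Z : Ω → D'} (hY : Measurable Y) (hZ : Measurable Z)
    (hk : Integrable (fun ω => k (Y ω) (Y ω)) P) (hl : Integrable (fun ω => l (Z ω) (Z ω)) P)
    (f : k.Space) (g : l.Space) :
    inner ℝ f (crossCov P k l Y Z g) = cov[fun ω => f (Y ω), fun ω => g (Z ω); P] := by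
  have hex : ∃ S : l.Space →L[ℝ] k.Space, ∀ (f : k.Space) (g : l.Space),
      inner ℝ f (S g) = cov[fun ω => f (Y ω), fun ω => g (Z ω); P] := by
    have hf := fun f => memLp_apply (P := P) hY hk f
    have hg := fun g => memLp_apply (P := P) hZ hl g
    let B : l.Space →ₗ[ℝ] k.Space →ₗ[ℝ] ℝ := LinearMap.mk₂ ℝ
      (fun g f => cov[fun ω => f (Y ω), fun ω => g (Z ω); P])
      (fun g₁ g₂ f => by
        have : (fun ω => (g₁ + g₂) (Z ω)) = (fun ω => g₁ (Z ω)) + fun ω => g₂ (Z ω) := by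
          ext; simp
        rw [this, covariance_add_right (hf f) (hg g₁) (hg g₂)])
      (fun c g f => by
        have : (fun ω => (c • g) (Z ω)) = c • fun ω => g (Z ω) := by ext; simp
        rw [this, covariance_smul_right, smul_eq_mul])
      (fun g f₁ f₂ => by
        have : (fun ω => (f₁ + f₂) (Y ω)) = (fun ω => f₁ (Y ω)) + fun ω => f₂ (Y ω) := by
          ext; simp
        rw [this, covariance_add_left (hf f₁) (hf f₂) (hg g)])
      (fun c g f => by
        have : (fun ω => (c • f) (Y ω)) = c • fun ω => f (Y ω) := by ext; simp
        rw [this, covariance_smul_left, smul_eq_mul])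
    let C : ℝ := √(∫ ω, k (Y ω) (Y ω) ∂P) * √(∫ ω, l (Z ω) (Z ω) ∂P)
    have hB : ∀ g f, ‖B g f‖ ≤ C * ‖g‖ * ‖f‖ := fun g f => by
      have h1 := Real.sqrt_le_sqrt (variance_apply_le (P := P) hY hk f)
      have h2 := Real.sqrt_le_sqrt (variance_apply_le (P := P) hZ hl g)
      rw [Real.sqrt_mul (sq_nonneg _), Real.sqrt_sq (norm_nonneg _)] at h1 h2
      calc ‖B g f‖ ≤ _ := abs_cov_le (hf f) (hg g)
        _ ≤ _ := mul_le_mul h1 h2 (Real.sqrt_nonneg _) (by positivity)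
        _ = C * ‖g‖ * ‖f‖ := by simp only [C]; ring
    let B' : l.Space →L[ℝ] k.Space →L[ℝ] ℝ := B.mkContinuous₂ C hB
    let S : l.Space →ₗ[ℝ] k.Space :=
      { toFun := fun g => (InnerProductSpace.toDual ℝ k.Space).symm (B' g)
        map_add' := fun g₁ g₂ => by simp
        map_smul' := fun c g => by simp }
    refine ⟨S.mkContinuous ‖B'‖ fun g => ?_, fun f g => ?_⟩
    · simpa [S] using B'.le_opNorm g
    · rw [real_inner_comm]
      simp [S, B', B]
  rw [crossCov, dif_pos hex]
  exact hex.choose_spec f g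

/-- The centered RKHS of `k` with respect to the law of `Y`: the closure of the range of the
covariance operator. -/
def centeredSpace (P : Measure Ω) (k : PosKernel D) (Y : Ω → D) : Submodule ℝ k.Space :=
  (LinearMap.range (crossCov P k k Y Y).toLinearMap).topologicalClosure

/-- The centered RKHS is dense in `L₂(P_Y)` modulo constants. -/
def DenseModConst (P : Measure Ω) (k : PosKernel D) (Y : Ω → D) : Prop :=
  ∀ h : D → ℝ, MemLp h 2 (P.map Y) → ∀ ε : ℝ≥0∞, 0 < ε →
    ∃ f ∈ centeredSpace P k Y, ∃ c : ℝ, eLpNorm (fun x => h x - (f x + c)) 2 (P.map Y) < ε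

end Covariance

/-- A kernel is universal on `S` if its RKHS is dense in `L₂(Q)` for every probability measure `Q`
carried by `S` for which the members of the RKHS are square integrable, `∫ k(x, x) dQ(x) < ∞`
(for a bounded kernel: for every probability measure carried by `S`). -/
def IsUniversalOn {D : Type*} [MeasurableSpace D] (k : PosKernel D) (S : Set D) : Prop :=
  ∀ Q : Measure D, IsProbabilityMeasure Q → Q Sᶜ = 0 → Integrable (fun x => k x x) Q →
    ∀ h : D → ℝ, MemLp h 2 Q → ∀ ε : ℝ≥0∞, 0 < ε →
      ∃ f : k.Space, eLpNorm (fun x => h x - f x) 2 Q < ε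

/-! ### Moore-Penrose inverse -/

section Pinv

variable {E F G : Type*} [NormedAddCommGroup E] [InnerProductSpace ℝ E] [CompleteSpace E]
  [NormedAddCommGroup F] [InnerProductSpace ℝ F]

theorem bijective_kerOrthogonal (A : E →L[ℝ] F) : Function.Bijective
    ((A.toLinearMap.rangeRestrict).domRestrict (LinearMap.ker A.toLinearMap)ᗮ) := by
  have hc : IsClosed (LinearMap.ker A.toLinearMap : Set E) := A.isClosed_ker
  have : CompleteSpace (LinearMap.ker A.toLinearMap) := hc.completeSpace_coe
  constructor
  · rw [injective_iff_map_eq_zero]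
    rintro ⟨x, hx⟩ h
    have h0 : x ∈ LinearMap.ker A.toLinearMap := by
      have := congrArg Subtype.val h
      simpa using this
    have := Submodule.inner_right_of_mem_orthogonal h0 hx
    simpa using this
  · rintro ⟨_, x, rfl⟩
    obtain ⟨y, hy, z, hz, rfl⟩ :=
      (LinearMap.ker A.toLinearMap).exists_add_mem_mem_orthogonal x
    refine ⟨⟨z, hz⟩, Subtype.ext ?_⟩
    have : A y = 0 := hy
    simp [this]

/-- The Moore-Penrose inverse of `A`, defined on `ran A`: it maps `h ∈ ran A` to the unique
`g ∈ (ker A)ᗮ` with `A g = h`. For self-adjoint `A`, `(ker A)ᗮ` is the closure of `ran A`. -/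
def pinv (A : E →L[ℝ] F) : LinearMap.range A.toLinearMap →ₗ[ℝ] E :=
  (LinearMap.ker A.toLinearMap)ᗮ.subtype ∘ₗ
    (LinearEquiv.ofBijective _ (bijective_kerOrthogonal A)).symm.toLinearMap

theorem apply_pinv (A : E →L[ℝ] F) (h : LinearMap.range A.toLinearMap) : A (pinv A h) = h := by
  have := (LinearEquiv.ofBijective _ (bijective_kerOrthogonal A)).apply_symm_apply h
  exact congrArg Subtype.val this

theorem pinv_mem (A : E →L[ℝ] F) (h : LinearMap.range A.toLinearMap) :
    pinv A h ∈ (LinearMap.ker A.toLinearMap)ᗮ := by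
  simp [pinv]

/-- The operator `A† B`, for `ran B ⊆ ran A`. -/
def pinvComp [AddCommGroup G] [Module ℝ G] (A : E →L[ℝ] F) (B : G →ₗ[ℝ] F)
    (h : LinearMap.range B ≤ LinearMap.range A.toLinearMap) : G →ₗ[ℝ] E :=
  pinv A ∘ₗ B.codRestrict _ fun x => h (LinearMap.mem_range_self B x)

end Pinv

/-! ### Regression operator, f-GSIR, conjoined conditional covariance operator -/

section Operators

variable {Ω D D' D'' : Type*} [MeasurableSpace Ω] [MeasurableSpace D] [MeasurableSpace D']
  [MeasurableSpace D'']

/-- `ran Σ_{YZ} ⊆ ran Σ_{YY}`. -/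
def RangeCond (P : Measure Ω) (k : PosKernel D) (l : PosKernel D') (Y : Ω → D) (Z : Ω → D') :
    Prop :=
  LinearMap.range (crossCov P k l Y Z).toLinearMap ≤
    LinearMap.range (crossCov P k k Y Y).toLinearMap

/-- The regression operator `R_{YZ} = Σ_{YY}† Σ_{YZ}`, on the centered RKHS of `l`. -/
def regressionOp (P : Measure Ω) (k : PosKernel D) (l : PosKernel D') (Y : Ω → D) (Z : Ω → D')
    (h : RangeCond P k l Y Z) : centeredSpace P l Z →ₗ[ℝ] k.Space :=
  (pinvComp (crossCov P k k Y Y) (crossCov P k l Y Z).toLinearMap h).domRestrict _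

/-- The constraint set at step `r` of the f-GSIR optimization problem: members `g` of the centered
RKHS with `⟪g, Σ_{YY} g⟫ = 1` and `⟪g, Σ_{YY} f_s⟫ = 0` for the previous solutions `f_s`, `s < r`. -/
def gsirFeasible (P : Measure Ω) (k : PosKernel D) (Y : Ω → D) {d : ℕ} (f : Fin d → k.Space)
    (r : Fin d) : Set k.Space :=
  {g | g ∈ centeredSpace P k Y ∧ inner ℝ g (crossCov P k k Y Y g) = 1 ∧
    ∀ s < r, inner ℝ g (crossCov P k k Y Y (f s)) = 0}

/-- `f_1, …, f_d` are successive solutions of the f-GSIR problem of predicting `Z` from `Y`: `f_r`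
maximizes `⟪g, Σ_{YZ} Σ_{ZY} g⟫` over the constraint set at step `r`. -/
def IsGSIR (P : Measure Ω) (k : PosKernel D) (l : PosKernel D') (Y : Ω → D) (Z : Ω → D') {d : ℕ}
    (f : Fin d → k.Space) : Prop :=
  ∀ r, f r ∈ gsirFeasible P k Y f r ∧
    IsMaxOn (fun g => inner ℝ g (crossCov P k l Y Z (crossCov P l k Z Y g)))
      (gsirFeasible P k Y f r) (f r)

/-- The sufficient predictor `U = (f_1(Y), …, f_d(Y))`. -/
def predictor {k : PosKernel D} {d : ℕ} (f : Fin d → k.Space) (Y : Ω → D) :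
    Ω → EuclideanSpace ℝ (Fin d) :=
  fun ω => WithLp.toLp 2 fun r => f r (Y ω)

/-- The conjoined conditional covariance operator of `Y` and `Z` given `U`:
`Σ_{VW} - Σ_{VU} Σ_{UU}† Σ_{UW}` with `V = (Y, U)`, `W = (Z, U)` and the product kernels `k × m` and
`l × m`, on the centered RKHS of `W`. -/
def ccco (P : Measure Ω) (k : PosKernel D) (l : PosKernel D') (m : PosKernel D'')
    (Y : Ω → D) (Z : Ω → D') (U : Ω → D'')
    (h : RangeCond P m (l.prod m) U (fun ω => (Z ω, U ω))) :
    centeredSpace P (l.prod m) (fun ω => (Z ω, U ω)) →ₗ[ℝ] (k.prod m).Space :=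
  ((crossCov P (k.prod m) (l.prod m) (fun ω => (Y ω, U ω)) (fun ω => (Z ω, U ω))).toLinearMap -
    (crossCov P (k.prod m) m (fun ω => (Y ω, U ω)) U).toLinearMap ∘ₗ
      pinvComp (crossCov P m m U U)
        (crossCov P m (l.prod m) U (fun ω => (Z ω, U ω))).toLinearMap h).domRestrict _

end Operators

/-! ### Conditional independence and graphical models -/

/-- `Y` and `Z` are conditionally independent given `W`:
`P(Y ∈ s, Z ∈ t | W) = P(Y ∈ s | W) P(Z ∈ t | W)` almost surely, for all measurable `s`, `t`.
(Mathlib's `CondIndepFun` is the same condition, for standard Borel `Ω` only.) -/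
def CondIndepGiven {Ω D D' D'' : Type*} [MeasurableSpace Ω] [MeasurableSpace D]
    [MeasurableSpace D'] [MeasurableSpace D''] (P : Measure Ω)
    (Y : Ω → D) (Z : Ω → D') (W : Ω → D'') : Prop :=
  ∀ (s : Set D) (t : Set D'), MeasurableSet s → MeasurableSet t →
    P[(Y ⁻¹' s ∩ Z ⁻¹' t).indicator (fun _ => (1 : ℝ)) | MeasurableSpace.comap W inferInstance]
      =ᵐ[P]
    P[(Y ⁻¹' s).indicator (fun _ => (1 : ℝ)) | MeasurableSpace.comap W inferInstance] *
      P[(Z ⁻¹' t).indicator (fun _ => (1 : ℝ)) | MeasurableSpace.comap W inferInstance]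

section Graph

variable {p : ℕ} {H : Fin p → Type*} {Ω : Type*}

/-- `X^{(i,j)} = (X^i, X^j)`. -/
def pairVec (X : Ω → ∀ k, H k) (i j : Fin p) : Ω → H i × H j := fun ω => (X ω i, X ω j)

/-- `X^{-(i,j)} = (X^k : k ∉ {i, j})`. -/
def restVec (X : Ω → ∀ k, H k) (i j : Fin p) : Ω → ∀ k : {k : Fin p // k ≠ i ∧ k ≠ j}, H k :=
  fun ω k => X ω k

/-- `X` follows a statistical graphical model with respect to `G`:
`(i, j)` is not an edge iff `X^i ⫫ X^j | X^{-(i,j)}`. -/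
def IsGraphicalModel [MeasurableSpace Ω] [∀ k, MeasurableSpace (H k)] (P : Measure Ω)
    (X : Ω → ∀ k, H k) (G : SimpleGraph (Fin p)) : Prop :=
  ∀ i j, i ≠ j →
    (¬ G.Adj i j ↔ CondIndepGiven P (fun ω => X ω i) (fun ω => X ω j) (restVec X i j))

end Graph

end FSGM

end

/-!
Write `Y = X^{-(i,j)}` and `Z = (X^i, X^j)`.

*Sufficiency of the predictor.* Density of the centered RKHS of `Y` in `L₂` modulo constants makes
`Σ_{YY}† Σ_{YZ} g` equal to `E[g(Z) | Y]` up to a constant (`condExp_eq_pinvComp`). For the form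
`cov(f(Y), g(Y))`, positive definite on the centered RKHS, the members orthogonal to the range of
the regression operator are killed by `Σ_{ZY}`, so the GSIR objective `‖Σ_{ZY} f‖²` only sees the
component of `f` in that range; hence `d` successive maximizers form a basis of it
(`span_range_eq_of_isMaxOn`, `IsGSIR.span_range_eq`). Thus `E[g(Z) | Y]` is a function of
`U = (f₁(Y), …, f_d(Y))` for all `g` in the centered RKHS of `Z`, and by density
`P(Z ∈ s | Y) = P(Z ∈ s | U)` for every event (`IsGSIR.condExp_predictor_eq`). The conditional
independence of `X^i` and `X^j` given `Y` or given `U` is a statement about these conditional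
probabilities, so the two are equivalent.

*The operator.* In the same way `Σ_{UU}† Σ_{UW} g` is `E[g(W) | U]` up to a constant, for
`W = (X^j, U)`, so the matrix coefficients of the conjoined conditional covariance operator are
`E[f(V) (g(W) - E[g(W) | U])]` with `V = (X^i, U)` (`inner_ccco`). They vanish under conditional
independence, by a π-λ argument on rectangles
(`CondIndepGiven.integral_mul_sub_condExp_eq_zero`). Conversely, if they vanish, universality lets
indicators of events replace `f(V)` and `g(W)`, and
`E[1_{X^i ∈ s, U ∈ u} (1_{X^j ∈ t} - P(X^j ∈ t | U))] = 0` for all `s`, `t`, `u` is conditional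
independence (`condIndepGiven_iff_setIntegral`).
-/

namespace FSGM

/-- The σ-algebra generated by `Y`. -/
local notation "σ(" Y ")" => MeasurableSpace.comap Y inferInstance

/-! ### Square-integrable functions and conditional expectations -/

section CondExp

variable {Ω : Type*} {m m' mΩ : MeasurableSpace Ω} {P : Measure Ω}

theorem integrable_fun_mul {a b : Ω → ℝ} (ha : MemLp a 2 P) (hb : MemLp b 2 P) :
    Integrable (fun ω => a ω * b ω) P :=
  ha.integrable_mul hb

/-- `∫ a D = 0` is a closed condition on `a` in `L²`. -/
theorem integral_mul_eq_zero_of_approx {a D : Ω → ℝ} (ha : MemLp a 2 P) (hD : MemLp D 2 P)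
    (h : ∀ ε : ℝ≥0∞, 0 < ε → ∃ b : Ω → ℝ, MemLp b 2 P ∧ ∫ ω, b ω * D ω ∂P = 0 ∧
      eLpNorm (fun ω => a ω - b ω) 2 P < ε) :
    ∫ ω, a ω * D ω ∂P = 0 := by
  by_contra hne
  set I := ∫ ω, a ω * D ω ∂P with hI
  set N := eLpNorm D 2 P with hN
  have hNtop : N + 1 ≠ ⊤ := by simpa using hD.2.ne
  obtain ⟨b, hb, hb0, hbe⟩ := h (‖I‖ₑ / (N + 1)) (ENNReal.div_pos (by simpa using hne) hNtop)
  have h1 : I = ∫ ω, (a ω - b ω) * D ω ∂P := by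
    have : (fun ω => (a ω - b ω) * D ω) = fun ω => a ω * D ω - b ω * D ω := by ext; ring
    rw [this, integral_sub (integrable_fun_mul ha hD) (integrable_fun_mul hb hD), hb0, sub_zero]
  have h2 : ‖I‖ₑ ≤ eLpNorm (fun ω => a ω - b ω) 2 P * N := by
    rw [h1]
    refine (enorm_integral_le_lintegral_enorm _).trans ?_
    rw [← eLpNorm_one_eq_lintegral_enorm]
    have := eLpNorm_smul_le_mul_eLpNorm (p := 2) (q := 2) (r := 1) hD.1 (ha.sub hb).1
    exact this
  have h3 : eLpNorm (fun ω => a ω - b ω) 2 P * (N + 1) < ‖I‖ₑ := by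
    exact (ENNReal.lt_div_iff_mul_lt (Or.inl (by simp)) (Or.inl hNtop)).1 hbe
  exact absurd (h2.trans (by gcongr; exact le_self_add)) (not_le.2 h3)

theorem memLp_indicator_one [IsFiniteMeasure P] {s : Set Ω} (hs : MeasurableSet s) :
    MemLp (s.indicator fun _ => (1 : ℝ)) 2 P :=
  memLp_indicator_const 2 hs 1 (Or.inr (measure_ne_top _ _))

theorem integral_indicator_one_mul {s : Set Ω} (hs : MeasurableSet s) (a : Ω → ℝ) :
    ∫ ω, s.indicator (fun _ => (1 : ℝ)) ω * a ω ∂P = ∫ ω in s, a ω ∂P := by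
  rw [← integral_indicator hs]
  congr 1; ext ω
  by_cases h : ω ∈ s <;> simp [h]

theorem integral_mul_condExp [IsFiniteMeasure P] (hm : m ≤ mΩ) {a b : Ω → ℝ}
    (ha : MemLp a 2 P) (hb : MemLp b 2 P) (hbm : AEStronglyMeasurable[m] b P) :
    ∫ ω, P[a | m] ω * b ω ∂P = ∫ ω, a ω * b ω ∂P := by
  have h := condExp_mul_of_aestronglyMeasurable_right (μ := P) (f := a) hbm
    (ha.integrable_mul hb) (ha.integrable (by norm_num))
  rw [← integral_condExp hm (f := fun ω => a ω * b ω)]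
  exact integral_congr_ae h.symm

/-- Conditional expectation is symmetric in `L²`, hence so is `a ↦ a - E[a | m]`. -/
theorem integral_mul_sub_condExp_comm [IsFiniteMeasure P] (hm : m ≤ mΩ) {a b : Ω → ℝ}
    (ha : MemLp a 2 P) (hb : MemLp b 2 P) :
    ∫ ω, a ω * (b ω - P[b | m] ω) ∂P = ∫ ω, b ω * (a ω - P[a | m] ω) ∂P := by
  have ha' : MemLp (P[a | m]) 2 P := ha.condExp (by norm_num)
  have hb' : MemLp (P[b | m]) 2 P := hb.condExp (by norm_num)
  have h1 := integral_mul_condExp hm ha hb' stronglyMeasurable_condExp.aestronglyMeasurable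
  have h2 := integral_mul_condExp hm hb ha' stronglyMeasurable_condExp.aestronglyMeasurable
  simp only [mul_sub]
  rw [integral_sub (integrable_fun_mul ha hb) (integrable_fun_mul ha hb'),
    integral_sub (integrable_fun_mul hb ha) (integrable_fun_mul hb ha'), ← h1, ← h2]
  simp only [mul_comm]

theorem memLp_sub_condExp [IsFiniteMeasure P] {a : Ω → ℝ} (ha : MemLp a 2 P) :
    MemLp (fun ω => a ω - P[a | m] ω) 2 P :=
  ha.sub (ha.condExp (by norm_num))

theorem integral_sub_condExp [IsFiniteMeasure P] (hm : m ≤ mΩ) {a : Ω → ℝ} (ha : Integrable a P) :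
    ∫ ω, (a ω - P[a | m] ω) ∂P = 0 := by
  rw [integral_sub ha integrable_condExp, integral_condExp hm, sub_self]

/-- If the residual `1_C - E[1_C | m]` of every `C ∈ m'` is orthogonal to `a`, then conditioning
`a` on `m'` amounts to conditioning it on the smaller `m`. -/
theorem condExp_eq_condExp_of_integral [IsFiniteMeasure P] (hmm : m ≤ m') (hm' : m' ≤ mΩ)
    {a : Ω → ℝ} (ha : MemLp a 2 P)
    (h : ∀ C, MeasurableSet[m'] C → ∫ ω, a ω * (C.indicator (fun _ => (1 : ℝ)) ω -
      P[C.indicator (fun _ => (1 : ℝ)) | m] ω) ∂P = 0) :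
    P[a | m] =ᵐ[P] P[a | m'] := by
  refine ae_eq_condExp_of_forall_setIntegral_eq hm' (ha.integrable (by norm_num))
    (fun _ _ _ => integrable_condExp.integrableOn) (fun C hC _ => ?_)
    (stronglyMeasurable_condExp.mono hmm).aestronglyMeasurable
  have h1 := h C hC
  have hi := memLp_indicator_one (P := P) (hm' _ hC)
  have hi' : Integrable (fun ω => C.indicator (fun _ => (1 : ℝ)) ω * a ω) P := hi.integrable_mul ha
  have hc' : Integrable (fun ω => C.indicator (fun _ => (1 : ℝ)) ω * P[a | m] ω) P :=
    hi.integrable_mul (ha.condExp (by norm_num))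
  rw [integral_mul_sub_condExp_comm (hmm.trans hm') ha hi] at h1
  simp only [mul_sub] at h1
  rw [integral_sub hi' hc', integral_indicator_one_mul (hm' _ hC),
    integral_indicator_one_mul (hm' _ hC)] at h1
  linarith

/-- A square-integrable `T` whose covariances with the members of an RKHS, dense in `L₂(P_Y)`
modulo constants, are those of `h(Y)` has conditional expectation `h(Y)` plus a constant. -/
theorem condExp_eq_of_covariance_eq [IsProbabilityMeasure P] {D : Type*} [MeasurableSpace D]
    {k : PosKernel D} {Y : Ω → D} (hY : Measurable Y)
    (hk : Integrable (fun ω => k (Y ω) (Y ω)) P) (hd : DenseModConst P k Y)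
    {T : Ω → ℝ} (hT : MemLp T 2 P) (h : k.Space)
    (hcov : ∀ u : k.Space, cov[fun ω => u (Y ω), T; P]
      = cov[fun ω => u (Y ω), fun ω => h (Y ω); P]) :
    P[T | σ(Y)] =ᵐ[P]
      fun ω => h (Y ω) + (∫ ω', T ω' ∂P - ∫ ω', h (Y ω') ∂P) := by
  set c : ℝ := ∫ ω', T ω' ∂P - ∫ ω', h (Y ω') ∂P with hc
  have hhY : MemLp (fun ω => h (Y ω)) 2 P := memLp_apply hY hk h
  have hg : MemLp (fun ω => h (Y ω) + c) 2 P := hhY.add (memLp_const c)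
  have hm : σ(Y) ≤ mΩ := hY.comap_le
  have hTg : MemLp (fun ω => T ω - (h (Y ω) + c)) 2 P := hT.sub hg
  have hTi := hT.integrable (μ := P) (by norm_num)
  have hhi := hhY.integrable (μ := P) (by norm_num)
  have h0 : ∫ ω, (T ω - (h (Y ω) + c)) ∂P = 0 := by
    rw [integral_sub hTi (hg.integrable (by norm_num)), integral_add hhi (integrable_const _)]
    simp [hc]
  have hu : ∀ u : k.Space, ∫ ω, u (Y ω) * (T ω - (h (Y ω) + c)) ∂P = 0 := fun u => by
    have hu := memLp_apply (P := P) hY hk u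
    have h1 := hcov u
    have h2 := covariance_eq_sub hu hTg
    have h3 : cov[fun ω => u (Y ω), fun ω => T ω - (h (Y ω) + c); P] = 0 := by
      rw [covariance_fun_sub_right hu hT hg, covariance_add_const_right hhi, h1, sub_self]
    rw [h3, h0, mul_zero, sub_zero] at h2
    exact h2.symm
  symm
  refine ae_eq_condExp_of_forall_setIntegral_eq hm hTi
    (fun _ _ _ => (hg.integrable (by norm_num)).integrableOn) ?_ ?_
  · rintro _ ⟨s, hs, rfl⟩ -
    have hsY := hY hs
    have hz := integral_mul_eq_zero_of_approx (P := P) (memLp_indicator_one hsY) hTg fun ε hε => by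
      obtain ⟨u, -, e, hue⟩ := hd (s.indicator fun _ => (1 : ℝ))
        (memLp_indicator_const 2 hs 1 (Or.inr (by
          rw [Measure.map_apply hY hs]; exact measure_ne_top _ _))) ε hε
      have huY := memLp_apply (P := P) hY hk u
      refine ⟨fun ω => u (Y ω) + e, huY.add (memLp_const e), ?_, ?_⟩
      · have : (fun ω => (u (Y ω) + e) * (T ω - (h (Y ω) + c)))
            = fun ω => u (Y ω) * (T ω - (h (Y ω) + c)) + e * (T ω - (h (Y ω) + c)) := by
          ext; ring
        rw [this, integral_add (integrable_fun_mul huY hTg)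
          ((hTg.integrable (by norm_num)).const_mul e), hu, integral_const_mul, h0]
        simp
      · rw [eLpNorm_map_measure _ hY.aemeasurable] at hue
        · exact hue
        · exact ((measurable_const.indicator hs).sub
            ((k.measurable_apply u).add_const e)).aestronglyMeasurable
    rw [integral_indicator_one_mul hsY, integral_sub hTi.integrableOn
      (hg.integrable (by norm_num)).integrableOn] at hz
    linarith
  · exact (((k.measurable_apply h).comp (comap_measurable Y)).add_const
      c).stronglyMeasurable.aestronglyMeasurable

end CondExp

/-! ### Conditional independence as orthogonality -/

section CondIndep

variable {Ω A B C : Type*} [mΩ : MeasurableSpace Ω] [MeasurableSpace A] [MeasurableSpace B]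
  [MeasurableSpace C] {P : Measure Ω} [IsProbabilityMeasure P]

/-- Orthogonality to the indicators of rectangles in `(Y, W)` gives orthogonality to all
square-integrable functions of `(Y, W)`, by a π-λ argument. -/
theorem integral_mul_eq_zero_of_rectangles {Y : Ω → A} {W : Ω → C} (hY : Measurable Y)
    (hW : Measurable W) {T : Ω → ℝ} (hT : MemLp T 2 P)
    (h : ∀ s t, MeasurableSet s → MeasurableSet t → ∫ ω in Y ⁻¹' s ∩ W ⁻¹' t, T ω ∂P = 0)
    {f : A × C → ℝ} (hf : Measurable f) (hf2 : MemLp (fun ω => f (Y ω, W ω)) 2 P) :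
    ∫ ω, f (Y ω, W ω) * T ω ∂P = 0 := by
  set V : Ω → A × C := fun ω => (Y ω, W ω) with hVdef
  have hV : Measurable V := hY.prodMk hW
  have hTi : Integrable T P := hT.integrable (by norm_num)
  have hset : ∀ F : Set (A × C), MeasurableSet F → ∫ ω in V ⁻¹' F, T ω ∂P = 0 := by
    intro F hF
    induction F, hF using MeasurableSpace.induction_on_inter generateFrom_prod.symm
      isPiSystem_prod with
    | empty => simp
    | basic F hF =>
      obtain ⟨s, hs, t, ht, rfl⟩ := hF
      exact h s t hs ht
    | compl F hF ih =>
      have h1 := integral_add_compl (μ := P) (hV hF) hTi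
      have h2 := h Set.univ Set.univ MeasurableSet.univ MeasurableSet.univ
      simp only [Set.preimage_univ, Set.inter_univ, setIntegral_univ] at h2
      rw [Set.preimage_compl]
      linarith
    | iUnion F hd hF ih =>
      rw [Set.preimage_iUnion, integral_iUnion (fun n => hV (hF n))
        (fun a b hab => (hd hab).preimage V) hTi.integrableOn]
      simp [ih]
  have h0 : (fun _ => (0 : ℝ)) =ᵐ[P] P[T | σ(V)] := by
    refine ae_eq_condExp_of_forall_setIntegral_eq hV.comap_le hTi
      (fun _ _ _ => (integrable_zero _ _ _).integrableOn) ?_ aestronglyMeasurable_const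
    rintro _ ⟨F, hF, rfl⟩ -
    rw [hset F hF]; simp
  have hfm : StronglyMeasurable[σ(V)] fun ω => f (V ω) :=
    (hf.comp (comap_measurable V)).stronglyMeasurable
  have h1 := integral_mul_condExp hV.comap_le hT hf2 hfm.aestronglyMeasurable
  simp only [mul_comm (f _)]
  rw [← h1]
  refine (integral_congr_ae (g := fun _ => (0 : ℝ)) ?_).trans (by simp)
  filter_upwards [h0] with ω hω
  simp [← hω]

/-- Conditional independence given `W`, tested on the sets `{Y ∈ s, W ∈ u}`. -/
theorem condIndepGiven_iff_setIntegral {Y : Ω → A} {Z : Ω → B} {W : Ω → C} (hY : Measurable Y)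
    (hZ : Measurable Z) (hW : Measurable W) :
    CondIndepGiven P Y Z W ↔ ∀ s t u, MeasurableSet s → MeasurableSet t → MeasurableSet u →
      ∫ ω in Y ⁻¹' s ∩ W ⁻¹' u, ((Z ⁻¹' t).indicator (fun _ => (1 : ℝ)) ω -
        P[(Z ⁻¹' t).indicator (fun _ => (1 : ℝ)) | σ(W)] ω) ∂P
          = 0 := by
  have hm : σ(W) ≤ mΩ := hW.comap_le
  have key : ∀ s t u, MeasurableSet s → MeasurableSet t → MeasurableSet u →
      ∫ ω in Y ⁻¹' s ∩ W ⁻¹' u, ((Z ⁻¹' t).indicator (fun _ => (1 : ℝ)) ω -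
        P[(Z ⁻¹' t).indicator (fun _ => (1 : ℝ)) | σ(W)] ω) ∂P
      = ∫ ω in W ⁻¹' u, (Y ⁻¹' s ∩ Z ⁻¹' t).indicator (fun _ => (1 : ℝ)) ω ∂P -
        ∫ ω in W ⁻¹' u, (P[(Y ⁻¹' s).indicator (fun _ => (1 : ℝ)) | σ(W)] *
          P[(Z ⁻¹' t).indicator (fun _ => (1 : ℝ)) | σ(W)]) ω ∂P := by
    intro s t u hs ht hu
    have hb := memLp_indicator_one (P := P) (hZ ht)
    have ha := memLp_indicator_one (P := P) (hY hs)
    have hb' : MemLp (P[(Z ⁻¹' t).indicator (fun _ => (1 : ℝ)) | σ(W)]) 2 P :=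
      hb.condExp (by norm_num)
    have hw := hW hu
    have hbu : MemLp ((W ⁻¹' u).indicator (P[(Z ⁻¹' t).indicator (fun _ => (1 : ℝ)) | σ(W)])) 2 P :=
      hb'.indicator hw
    have h1 := integral_mul_condExp hm ha hbu
      (stronglyMeasurable_condExp.indicator
        (show MeasurableSet[σ(W)] (W ⁻¹' u) from ⟨u, hu, rfl⟩)).aestronglyMeasurable
    rw [integral_sub (hb.integrable (by norm_num)).integrableOn
      (hb'.integrable (by norm_num)).integrableOn]
    congr 1
    · rw [← integral_indicator ((hY hs).inter hw), ← integral_indicator hw]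
      congr 1; ext ω
      by_cases h1 : ω ∈ Y ⁻¹' s <;> by_cases h2 : ω ∈ Z ⁻¹' t <;> by_cases h3 : ω ∈ W ⁻¹' u <;>
        simp only [Set.indicator, Set.mem_inter_iff, h1, h2, h3] <;> simp
    · rw [← integral_indicator ((hY hs).inter hw), ← integral_indicator hw]
      refine Eq.trans ?_ (h1.symm.trans ?_)
      · congr 1; ext ω
        by_cases h1 : ω ∈ Y ⁻¹' s <;> by_cases h3 : ω ∈ W ⁻¹' u <;>
          simp only [Set.indicator, Set.mem_inter_iff, h1, h3] <;> simp
      · congr 1; ext ω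
        by_cases h3 : ω ∈ W ⁻¹' u <;> simp [h3]
  have hint : ∀ s t, MeasurableSet s → MeasurableSet t →
      Integrable (P[(Y ⁻¹' s).indicator (fun _ => (1 : ℝ)) | σ(W)] *
        P[(Z ⁻¹' t).indicator (fun _ => (1 : ℝ)) | σ(W)]) P := fun s t hs ht =>
    ((memLp_indicator_one (hY hs)).condExp (by norm_num)).integrable_mul
      ((memLp_indicator_one (hZ ht)).condExp (by norm_num))
  have hst : ∀ s t, MeasurableSet s → MeasurableSet t →
      Integrable ((Y ⁻¹' s ∩ Z ⁻¹' t).indicator (fun _ => (1 : ℝ))) P := fun s t hs ht =>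
    (memLp_indicator_one ((hY hs).inter (hZ ht))).integrable (by norm_num)
  constructor
  · intro h s t u hs ht hu
    rw [key s t u hs ht hu, ← setIntegral_condExp hm (hst s t hs ht) ⟨u, hu, rfl⟩, sub_eq_zero]
    exact integral_congr_ae (ae_restrict_of_ae (h s t hs ht))
  · intro h s t hs ht
    symm
    refine ae_eq_condExp_of_forall_setIntegral_eq hm (hst s t hs ht)
      (fun _ _ _ => (hint s t hs ht).integrableOn) ?_
      (stronglyMeasurable_condExp.mul stronglyMeasurable_condExp).aestronglyMeasurable
    rintro _ ⟨u, hu, rfl⟩ -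
    have h1 := h s t u hs ht hu
    rw [key s t u hs ht hu] at h1
    linarith

/-- Under conditional independence of `Y` and `Z` given `W`, the residual of any square-integrable
function of `(Z, W)` given `W` is orthogonal to every square-integrable function of `(Y, W)`. -/
theorem CondIndepGiven.integral_mul_sub_condExp_eq_zero {Y : Ω → A} {Z : Ω → B} {W : Ω → C}
    (hY : Measurable Y) (hZ : Measurable Z) (hW : Measurable W) (h : CondIndepGiven P Y Z W)
    {f : A × C → ℝ} (hf : Measurable f) (hf2 : MemLp (fun ω => f (Y ω, W ω)) 2 P)
    {g : B × C → ℝ} (hg : Measurable g) (hg2 : MemLp (fun ω => g (Z ω, W ω)) 2 P) :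
    ∫ ω, f (Y ω, W ω) * (g (Z ω, W ω) - P[fun ω => g (Z ω, W ω) |
      σ(W)] ω) ∂P = 0 := by
  rw [condIndepGiven_iff_setIntegral hY hZ hW] at h
  have hm : σ(W) ≤ mΩ := hW.comap_le
  rw [integral_mul_sub_condExp_comm hm hf2 hg2]
  refine integral_mul_eq_zero_of_rectangles hZ hW (memLp_sub_condExp hf2) (fun t u ht hu => ?_)
    hg hg2
  have htu := (hZ ht).inter (hW hu)
  rw [← integral_indicator_one_mul htu,
    integral_mul_sub_condExp_comm hm (memLp_indicator_one htu) hf2]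
  refine integral_mul_eq_zero_of_rectangles hY hW
    (memLp_sub_condExp (memLp_indicator_one htu)) (fun s u' hs hu' => ?_) hf hf2
  rw [← h s t (u ∩ u') hs ht (hu.inter hu'), ← integral_indicator ((hY hs).inter (hW hu')),
    ← integral_indicator ((hY hs).inter (hW (hu.inter hu')))]
  -- `1_{W ∈ u}` may be taken out of the conditional expectation
  have hpull : P[(Z ⁻¹' t ∩ W ⁻¹' u).indicator (fun _ => (1 : ℝ)) | σ(W)] =ᵐ[P]
      (W ⁻¹' u).indicator (P[(Z ⁻¹' t).indicator (fun _ => (1 : ℝ)) | σ(W)]) := by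
    have := condExp_indicator (μ := P) (m := σ(W)) (s := W ⁻¹' u)
      ((memLp_indicator_one (P := P) (hZ ht)).integrable (by norm_num)) ⟨u, hu, rfl⟩
    rwa [Set.indicator_indicator, Set.inter_comm] at this
  refine integral_congr_ae ?_
  filter_upwards [hpull] with ω hω
  by_cases h1 : ω ∈ Y ⁻¹' s <;> by_cases h2 : ω ∈ W ⁻¹' u <;> by_cases h3 : ω ∈ W ⁻¹' u' <;>
    by_cases h4 : ω ∈ Z ⁻¹' t <;>
    simp only [Set.indicator, hω, Set.preimage_inter, Set.mem_inter_iff, h1, h2, h3, h4] <;> simp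

end CondIndep

/-! ### Successive maximizers of a quadratic form -/

section Maximizers

variable {E F : Type*} [NormedAddCommGroup E] [InnerProductSpace ℝ E]
  [NormedAddCommGroup F] [InnerProductSpace ℝ F]

/-- Let `⟪x, T y⟫` be symmetric, and positive definite on `M`, and let `S ≤ M` have dimension `d`.
If `B` kills the members of `M` that are `T`-orthogonal to `S` and is injective on `S`, then `d`
successive maximizers of `‖B g‖²` over the `T`-unit vectors of `M` span `S`: removing from a unit
vector its component `T`-orthogonal to `S` and normalizing again increases the objective. -/
theorem span_range_eq_of_isMaxOn {T : E →ₗ[ℝ] E} (hT : ∀ x y, inner ℝ x (T y) = inner ℝ y (T x))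
    {M : Submodule ℝ E} (hpos : ∀ x ∈ M, x ≠ 0 → 0 < inner ℝ x (T x)) (B : E →ₗ[ℝ] F)
    {S : Submodule ℝ E} [FiniteDimensional ℝ S] (hSM : S ≤ M) {d : ℕ}
    (hd : Module.finrank ℝ S = d)
    (hker : ∀ x ∈ M, (∀ s ∈ S, inner ℝ s (T x) = 0) → B x = 0)
    (hinj : ∀ s ∈ S, B s = 0 → s = 0) {f : Fin d → E} {K : Fin d → Set E}
    (hK : ∀ r g, g ∈ K r ↔ g ∈ M ∧ inner ℝ g (T g) = 1 ∧ ∀ s < r, inner ℝ g (T (f s)) = 0)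
    (hf : ∀ r, f r ∈ K r ∧ IsMaxOn (fun g => ‖B g‖ ^ 2) (K r) (f r)) :
    Submodule.span ℝ (Set.range f) = S := by
  let b : LinearMap.BilinForm ℝ E := (innerₗ E).compl₂ T
  have hb : ∀ x y, b x y = inner ℝ x (T y) := fun x y => rfl
  have hrefl : b.IsRefl := fun x y h => by rw [hb] at h ⊢; rw [hT]; exact h
  have hnondeg : (b.restrict S).Nondegenerate := by
    refine ⟨fun x hx => ?_, fun x hx => ?_⟩ <;>
    · by_contra hne
      have h1 : b x x = 0 := hx x
      have h2 := hpos x (hSM x.2) (by simpa using hne)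
      rw [hb] at h1
      exact h2.ne' h1
  have hdecomp : ∀ x, ∃ s ∈ S, ∀ s' ∈ S, b s s' = b x s' := fun x => by
    refine ⟨((b.restrict S).toDual hnondeg).symm (b x ∘ₗ S.subtype), Subtype.coe_prop _,
      fun s' hs' => ?_⟩
    exact LinearMap.BilinForm.apply_toDual_symm_apply (hB := hnondeg) (b x ∘ₗ S.subtype) ⟨s', hs'⟩
  have hmem : ∀ r, f r ∈ S := by
    intro r
    induction r using WellFoundedLT.induction with
    | _ r ih =>
    obtain ⟨hfr, hmax⟩ := hf r
    obtain ⟨hfM, hf1, hforth⟩ := (hK r _).1 hfr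
    obtain ⟨s, hs, hsb⟩ := hdecomp (f r)
    have ht : ∀ s' ∈ S, inner ℝ s' (T (f r - s)) = 0 := fun s' hs' => by
      have := hsb s' hs'
      rw [hb, hb] at this
      rw [hT, inner_sub_left, this, sub_self]
    have htM : f r - s ∈ M := M.sub_mem hfM (hSM hs)
    have hBs : B (f r) = B s := by
      rw [← sub_eq_zero, ← map_sub]
      exact hker _ htM ht
    by_contra hrS
    have htne : f r - s ≠ 0 := fun h => hrS (by rwa [sub_eq_zero.1 h])
    have htpos := hpos _ htM htne
    have hsplit : inner ℝ s (T s) + inner ℝ (f r - s) (T (f r - s)) = 1 := by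
      have h1 := ht s hs
      rw [map_sub, inner_sub_right, sub_eq_zero] at h1
      have h2 := hT s (f r)
      rw [← hf1, map_sub, inner_sub_right, inner_sub_left, inner_sub_left]
      linarith
    -- comparison of `f r` with the normalization of `s'`
    have hcomp : ∀ s' ∈ S, s' ≠ 0 → (∀ q < r, inner ℝ s' (T (f q)) = 0) →
        ‖B s'‖ ^ 2 ≤ ‖B s‖ ^ 2 * inner ℝ s' (T s') := fun s' hs' hne hq => by
      have hc := hpos s' (hSM hs') hne
      set c := inner ℝ s' (T s') with hcdef
      have hcc : (√c)⁻¹ * ((√c)⁻¹ * c) = 1 := by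
        have h0 := (Real.sqrt_pos.2 hc).ne'
        field_simp
        exact (Real.sq_sqrt hc.le).symm
      have hg : (√c)⁻¹ • s' ∈ K r := by
        refine (hK r _).2 ⟨M.smul_mem _ (hSM hs'), ?_, fun q hqr => ?_⟩
        · rw [map_smul, inner_smul_left, inner_smul_right, ← hcdef]
          simpa using hcc
        · rw [inner_smul_left, hq q hqr, mul_zero]
      have h1 : ‖B ((√c)⁻¹ • s')‖ ^ 2 ≤ ‖B (f r)‖ ^ 2 := hmax hg
      rw [map_smul, norm_smul, mul_pow, Real.norm_eq_abs, sq_abs, inv_pow, Real.sq_sqrt hc.le,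
        hBs, inv_mul_le_iff₀ hc] at h1
      linarith
    by_cases hs0 : s = 0
    · -- if `s = 0`, the objective vanishes at `f r` but not at a nonzero `s'` in `S` that is
      -- `T`-orthogonal to `f q` for `q < r`; it exists since `r < d = dim S`
      let ev : S →ₗ[ℝ] (Fin r → ℝ) := LinearMap.pi fun q =>
        (innerₗ E (T (f ⟨q, q.2.trans r.2⟩))) ∘ₗ S.subtype
      have hev : LinearMap.ker ev ≠ ⊥ := by
        refine LinearMap.ker_ne_bot_of_finrank_lt ?_
        rw [hd, Module.finrank_fin_fun]
        exact r.2
      obtain ⟨s', hs', hne⟩ := (Submodule.ne_bot_iff _).1 hev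
      have hne' : (s' : E) ≠ 0 := by simpa using hne
      have h1 := hcomp s' s'.2 hne' fun q hqr => by
        have := congrFun (LinearMap.mem_ker.1 hs') ⟨q, hqr⟩
        rw [real_inner_comm]
        exact this
      rw [hs0, map_zero, norm_zero, zero_pow two_ne_zero, zero_mul] at h1
      have h2 : ‖B s'‖ ^ 2 = 0 := le_antisymm h1 (sq_nonneg _)
      exact hne' (hinj s' s'.2 (by simpa using h2))
    · have h1 := hcomp s hs hs0 fun q hqr => by
        have h2 := hsb (f q) (ih q hqr)
        rw [hb, hb] at h2
        rw [h2, hforth q hqr]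
      have h2 : 0 < ‖B s‖ ^ 2 := by
        have : B s ≠ 0 := fun h => hs0 (hinj s hs h)
        positivity
      nlinarith
  have hli : LinearIndependent ℝ f := by
    refine LinearMap.BilinForm.linearIndependent_of_iIsOrtho (B := b) (fun q r hqr => ?_)
      fun r => ?_
    · change b (f q) (f r) = 0
      rcases lt_or_gt_of_ne hqr with h | h
      · rw [hb, hT]; exact ((hK r _).1 (hf r).1).2.2 q h
      · exact ((hK q _).1 (hf q).1).2.2 r h
    · rw [hb, ((hK r _).1 (hf r).1).2.1]; exact one_ne_zero
  refine Submodule.eq_of_le_of_finrank_eq (Submodule.span_le.2 ?_) ?_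
  · rintro _ ⟨r, rfl⟩; exact hmem r
  · rw [finrank_span_eq_card hli, hd, Fintype.card_fin]

end Maximizers

/-! ### Covariance operators -/

section Covariance

variable {Ω D D' : Type*} [mΩ : MeasurableSpace Ω] [MeasurableSpace D] [MeasurableSpace D']
  {P : Measure Ω} {k : PosKernel D} {l : PosKernel D'} {Y : Ω → D} {Z : Ω → D'}

theorem crossCov_pinvComp (h : RangeCond P k l Y Z) (g : l.Space) :
    crossCov P k k Y Y (pinvComp (crossCov P k k Y Y) (crossCov P k l Y Z).toLinearMap h g) =
      crossCov P k l Y Z g :=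
  apply_pinv (crossCov P k k Y Y) _

variable [IsProbabilityMeasure P]

theorem inner_crossCov_self (hY : Measurable Y) (hk : Integrable (fun ω => k (Y ω) (Y ω)) P)
    (x : k.Space) : inner ℝ x (crossCov P k k Y Y x) = Var[fun ω => x (Y ω); P] := by
  rw [inner_crossCov hY hY hk hk, covariance_self (memLp_apply hY hk x).aemeasurable]

theorem inner_crossCov_comm (hY : Measurable Y) (hk : Integrable (fun ω => k (Y ω) (Y ω)) P)
    (x y : k.Space) :
    inner ℝ x (crossCov P k k Y Y y) = inner ℝ y (crossCov P k k Y Y x) := by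
  rw [inner_crossCov hY hY hk hk, inner_crossCov hY hY hk hk, covariance_comm]

theorem inner_crossCov_swap (hY : Measurable Y) (hZ : Measurable Z)
    (hk : Integrable (fun ω => k (Y ω) (Y ω)) P) (hl : Integrable (fun ω => l (Z ω) (Z ω)) P)
    (x : k.Space) (y : l.Space) :
    inner ℝ x (crossCov P k l Y Z y) = inner ℝ y (crossCov P l k Z Y x) := by
  rw [inner_crossCov hY hZ hk hl, inner_crossCov hZ hY hl hk, covariance_comm]

theorem covariance_eq_zero_of_variance_eq_zero {A B : Ω → ℝ} (hA : MemLp A 2 P)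
    (hB : MemLp B 2 P) (h : Var[A; P] = 0) : cov[A, B; P] = 0 := by
  have := abs_cov_le hA hB
  rw [h, Real.sqrt_zero, zero_mul] at this
  exact abs_eq_zero.1 (le_antisymm this (abs_nonneg _))

theorem centeredSpace_eq_orthogonal_ker (hY : Measurable Y)
    (hk : Integrable (fun ω => k (Y ω) (Y ω)) P) :
    centeredSpace P k Y = (LinearMap.ker (crossCov P k k Y Y).toLinearMap)ᗮ := by
  have h : (LinearMap.range (crossCov P k k Y Y).toLinearMap)ᗮ =
      LinearMap.ker (crossCov P k k Y Y).toLinearMap := by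
    ext x
    rw [Submodule.mem_orthogonal, LinearMap.mem_ker]
    constructor
    · intro hx
      refine ext_inner_left ℝ fun v => ?_
      rw [inner_zero_right]
      change inner ℝ v (crossCov P k k Y Y x) = 0
      rw [inner_crossCov_comm hY hk, real_inner_comm]
      exact hx _ ⟨v, rfl⟩
    · rintro hx _ ⟨v, rfl⟩
      change inner ℝ (crossCov P k k Y Y v) x = 0
      rw [real_inner_comm, inner_crossCov_comm hY hk]
      change inner ℝ v ((crossCov P k k Y Y).toLinearMap x) = 0
      rw [hx, inner_zero_right]
  rw [centeredSpace, ← Submodule.orthogonal_orthogonal_eq_closure, h]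

/-- Members of the RKHS orthogonal to the centered RKHS are almost surely constant along `Y`, so
that covariances are determined by the centered RKHS. -/
theorem covariance_eq_zero_of_centeredSpace (hY : Measurable Y)
    (hk : Integrable (fun ω => k (Y ω) (Y ω)) P) {T : Ω → ℝ} (hT : MemLp T 2 P)
    (h : ∀ g ∈ centeredSpace P k Y, cov[fun ω => g (Y ω), T; P] = 0) (g : k.Space) :
    cov[fun ω => g (Y ω), T; P] = 0 := by
  have : CompleteSpace (LinearMap.ker (crossCov P k k Y Y).toLinearMap) :=
    (crossCov P k k Y Y).isClosed_ker.completeSpace_coe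
  obtain ⟨y, hy, z, hz, rfl⟩ :=
    (LinearMap.ker (crossCov P k k Y Y).toLinearMap).exists_add_mem_mem_orthogonal g
  have hyY := memLp_apply (P := P) hY hk y
  have hzY := memLp_apply (P := P) hY hk z
  have h1 : (fun ω => (y + z) (Y ω)) = (fun ω => y (Y ω)) + fun ω => z (Y ω) := by ext; simp
  have h2 : Var[fun ω => y (Y ω); P] = 0 := by
    rw [← inner_crossCov_self hY hk]
    change inner ℝ y ((crossCov P k k Y Y).toLinearMap y) = 0
    rw [LinearMap.mem_ker.1 hy, inner_zero_right]
  rw [h1, covariance_add_left hyY hzY hT, covariance_eq_zero_of_variance_eq_zero hyY hT h2,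
    h z (by rwa [centeredSpace_eq_orthogonal_ker hY hk]), add_zero]

theorem inner_crossCov_self_pos (hY : Measurable Y)
    (hk : Integrable (fun ω => k (Y ω) (Y ω)) P) {x : k.Space} (hx : x ∈ centeredSpace P k Y)
    (hne : x ≠ 0) : 0 < inner ℝ x (crossCov P k k Y Y x) := by
  rw [inner_crossCov_self hY hk]
  refine lt_of_le_of_ne (variance_nonneg _ _) fun h0 => hne ?_
  have hker : x ∈ LinearMap.ker (crossCov P k k Y Y).toLinearMap := by
    rw [LinearMap.mem_ker]
    refine ext_inner_left ℝ fun v => ?_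
    rw [inner_zero_right]
    change inner ℝ v (crossCov P k k Y Y x) = 0
    rw [inner_crossCov hY hY hk hk, covariance_comm]
    exact covariance_eq_zero_of_variance_eq_zero (memLp_apply hY hk x) (memLp_apply hY hk v) h0.symm
  rw [centeredSpace_eq_orthogonal_ker hY hk] at hx
  exact inner_self_eq_zero.1 (hx x hker)

theorem pinvComp_mem_centeredSpace (hY : Measurable Y)
    (hk : Integrable (fun ω => k (Y ω) (Y ω)) P) (h : RangeCond P k l Y Z) (g : l.Space) :
    pinvComp (crossCov P k k Y Y) (crossCov P k l Y Z).toLinearMap h g ∈ centeredSpace P k Y := by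
  rw [centeredSpace_eq_orthogonal_ker hY hk]
  exact pinv_mem _ _

theorem covariance_pinvComp (hY : Measurable Y) (hZ : Measurable Z)
    (hk : Integrable (fun ω => k (Y ω) (Y ω)) P) (hl : Integrable (fun ω => l (Z ω) (Z ω)) P)
    (h : RangeCond P k l Y Z) (u : k.Space) (g : l.Space) :
    cov[fun ω => u (Y ω), fun ω =>
        pinvComp (crossCov P k k Y Y) (crossCov P k l Y Z).toLinearMap h g (Y ω); P] =
      cov[fun ω => u (Y ω), fun ω => g (Z ω); P] := by
  rw [← inner_crossCov hY hY hk hk, crossCov_pinvComp, inner_crossCov hY hZ hk hl]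

/-- The regression operator computes conditional expectations, up to a constant. -/
theorem condExp_eq_pinvComp (hY : Measurable Y) (hZ : Measurable Z)
    (hk : Integrable (fun ω => k (Y ω) (Y ω)) P) (hl : Integrable (fun ω => l (Z ω) (Z ω)) P)
    (h : RangeCond P k l Y Z) (hd : DenseModConst P k Y) (g : l.Space) :
    ∃ c : ℝ, P[fun ω => g (Z ω) | σ(Y)] =ᵐ[P] fun ω =>
      pinvComp (crossCov P k k Y Y) (crossCov P k l Y Z).toLinearMap h g (Y ω) + c :=
  ⟨_, condExp_eq_of_covariance_eq hY hk hd (memLp_apply hZ hl g) _ fun u =>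
    (covariance_pinvComp hY hZ hk hl h u g).symm⟩

end Covariance

/-! ### Sufficiency of the f-GSIR predictor -/

section Sufficiency

variable {Ω D D' : Type*} [MeasurableSpace D] [MeasurableSpace D']
  {k : PosKernel D} {l : PosKernel D'} {Y : Ω → D} {Z : Ω → D'} {d : ℕ}

theorem measurable_predictor (f : Fin d → k.Space) : Measurable[σ(Y)] (predictor f Y) := by
  have h : Measurable fun y : D => WithLp.toLp 2 fun r => f r y :=
    (WithLp.measurable_toLp 2 _).comp (measurable_pi_lambda _ fun r => k.measurable_apply (f r))
  exact h.comp (comap_measurable Y)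

theorem measurable_comap_predictor_of_mem_span (f : Fin d → k.Space) {s : k.Space}
    (hs : s ∈ Submodule.span ℝ (Set.range f)) :
    Measurable[σ(predictor f Y)] fun ω => s (Y ω) := by
  induction hs using Submodule.span_induction with
  | mem x hx =>
    obtain ⟨r, rfl⟩ := hx
    have h : Measurable fun v : EuclideanSpace ℝ (Fin d) => v r := by fun_prop
    exact h.comp (comap_measurable (predictor f Y))
  | zero =>
    have : (fun ω => (0 : k.Space) (Y ω)) = fun _ => (0 : ℝ) := by ext; simp
    rw [this]; exact measurable_const
  | add x y _ _ hx hy =>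
    have : (fun ω => (x + y) (Y ω)) = fun ω => x (Y ω) + y (Y ω) := by ext; simp
    rw [this]; exact hx.add hy
  | smul c x _ hx =>
    have : (fun ω => (c • x) (Y ω)) = fun ω => c * x (Y ω) := by ext; simp
    rw [this]; exact hx.const_mul c

variable [mΩ : MeasurableSpace Ω] {P : Measure Ω} [IsProbabilityMeasure P]

theorem IsGSIR.span_range_eq (hY : Measurable Y) (hZ : Measurable Z)
    (hk : Integrable (fun ω => k (Y ω) (Y ω)) P) (hl : Integrable (fun ω => l (Z ω) (Z ω)) P)
    (hR : RangeCond P k l Y Z) [FiniteDimensional ℝ (LinearMap.range (regressionOp P k l Y Z hR))]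
    (hrank : Module.finrank ℝ (LinearMap.range (regressionOp P k l Y Z hR)) = d)
    {f : Fin d → k.Space} (hf : IsGSIR P k l Y Z f) :
    Submodule.span ℝ (Set.range f) = LinearMap.range (regressionOp P k l Y Z hR) := by
  have hcov : ∀ (u : k.Space) (g : centeredSpace P l Z),
      inner ℝ u (crossCov P k k Y Y (regressionOp P k l Y Z hR g)) =
        inner ℝ (g : l.Space) (crossCov P l k Z Y u) := fun u g => by
    rw [inner_crossCov_swap hZ hY hl hk]
    exact congrArg _ (crossCov_pinvComp hR (g : l.Space))
  refine span_range_eq_of_isMaxOn (T := (crossCov P k k Y Y).toLinearMap)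
    (inner_crossCov_comm hY hk) (fun x hx hne => inner_crossCov_self_pos hY hk hx hne)
    (crossCov P l k Z Y).toLinearMap ?_ hrank ?_ ?_ (K := gsirFeasible P k Y f)
    (fun r g => Iff.rfl) fun r => ⟨(hf r).1, ?_⟩
  · rintro _ ⟨g, rfl⟩
    exact pinvComp_mem_centeredSpace hY hk hR _
  · intro x _ hx
    refine ext_inner_left ℝ fun g => ?_
    rw [inner_zero_right]
    change inner ℝ g (crossCov P l k Z Y x) = 0
    rw [inner_crossCov hZ hY hl hk]
    refine covariance_eq_zero_of_centeredSpace hZ hl (memLp_apply hY hk x) (fun g hg => ?_) g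
    rw [← inner_crossCov hZ hY hl hk, ← hcov x ⟨g, hg⟩, inner_crossCov_comm hY hk]
    exact hx _ ⟨⟨g, hg⟩, rfl⟩
  · rintro s ⟨g, rfl⟩ hs
    by_contra hne
    refine (inner_crossCov_self_pos hY hk (pinvComp_mem_centeredSpace hY hk hR _) hne).ne' ?_
    refine (hcov _ g).trans ?_
    change crossCov P l k Z Y _ = 0 at hs
    exact (congrArg (inner ℝ (g : l.Space)) hs).trans (inner_zero_right _)
  · have h := (hf r).2
    have hobj : (fun g => inner ℝ g (crossCov P k l Y Z (crossCov P l k Z Y g))) =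
        fun g => ‖crossCov P l k Z Y g‖ ^ 2 := by
      ext g
      rw [inner_crossCov_swap hY hZ hk hl, real_inner_self_eq_norm_sq]
    rw [hobj] at h
    exact h

/-- The predictor is sufficient: conditioning an event about `Z` on `Y` is the same as conditioning
it on `U = (f₁(Y), …, f_d(Y))`. -/
theorem IsGSIR.condExp_predictor_eq (hY : Measurable Y) (hZ : Measurable Z)
    (hk : Integrable (fun ω => k (Y ω) (Y ω)) P) (hl : Integrable (fun ω => l (Z ω) (Z ω)) P)
    (hR : RangeCond P k l Y Z) [FiniteDimensional ℝ (LinearMap.range (regressionOp P k l Y Z hR))]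
    (hrank : Module.finrank ℝ (LinearMap.range (regressionOp P k l Y Z hR)) = d)
    (hdY : DenseModConst P k Y) (hdZ : DenseModConst P l Z)
    {f : Fin d → k.Space} (hf : IsGSIR P k l Y Z f) {s : Set D'} (hs : MeasurableSet s) :
    P[(Z ⁻¹' s).indicator (fun _ => (1 : ℝ)) | σ(predictor f Y)] =ᵐ[P]
      P[(Z ⁻¹' s).indicator (fun _ => (1 : ℝ)) | σ(Y)] := by
  have hmm : σ(predictor f Y) ≤ σ(Y) := (measurable_predictor f).comap_le
  have hm' : σ(Y) ≤ mΩ := hY.comap_le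
  -- on the centered RKHS the claim holds because the regression operator takes values in `span f`
  have hcenter : ∀ g ∈ centeredSpace P l Z,
      P[fun ω => g (Z ω) | σ(predictor f Y)] =ᵐ[P] P[fun ω => g (Z ω) | σ(Y)] := by
    intro g hg
    obtain ⟨c, hc⟩ := condExp_eq_pinvComp hY hZ hk hl hR hdY g
    have hspan : pinvComp (crossCov P k k Y Y) (crossCov P k l Y Z).toLinearMap hR g ∈
        Submodule.span ℝ (Set.range f) := by
      rw [hf.span_range_eq hY hZ hk hl hR hrank]
      exact ⟨⟨g, hg⟩, rfl⟩
    have hmeas := ((measurable_comap_predictor_of_mem_span (Y := Y) f hspan).add_const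
      c).stronglyMeasurable
    calc P[fun ω => g (Z ω) | σ(predictor f Y)]
        =ᵐ[P] P[P[fun ω => g (Z ω) | σ(Y)] | σ(predictor f Y)] :=
          (condExp_condExp_of_le hmm hm').symm
      _ =ᵐ[P] P[fun ω => pinvComp (crossCov P k k Y Y) (crossCov P k l Y Z).toLinearMap hR g (Y ω)
            + c | σ(predictor f Y)] := condExp_congr_ae hc
      _ = _ := condExp_of_stronglyMeasurable (hmm.trans hm') hmeas
          (((memLp_apply hY hk _).add (memLp_const c)).integrable (by norm_num))
      _ =ᵐ[P] _ := hc.symm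
  have hi := memLp_indicator_one (P := P) (hZ hs)
  refine condExp_eq_condExp_of_integral hmm hm' hi fun C hC => ?_
  have hCi := memLp_indicator_one (P := P) (hm' _ hC)
  have hr := memLp_sub_condExp (m := σ(predictor f Y)) hCi
  refine integral_mul_eq_zero_of_approx hi hr fun ε hε => ?_
  obtain ⟨g, hg, c, hgc⟩ := hdZ (s.indicator fun _ => (1 : ℝ))
    (memLp_indicator_const 2 hs 1 (Or.inr (by
      rw [Measure.map_apply hZ hs]; exact measure_ne_top _ _))) ε hε
  have hgZ := memLp_apply (P := P) hZ hl g
  refine ⟨fun ω => g (Z ω) + c, hgZ.add (memLp_const c), ?_, ?_⟩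
  · simp only [add_mul]
    rw [integral_add (integrable_fun_mul hgZ hr) ((hr.integrable (by norm_num)).const_mul c),
      integral_const_mul, integral_sub_condExp (hmm.trans hm') (hCi.integrable (by norm_num)),
      mul_zero, add_zero, integral_mul_sub_condExp_comm (hmm.trans hm') hgZ hCi,
      integral_indicator_one_mul (hm' _ hC),
      integral_sub (hgZ.integrable (by norm_num)).integrableOn integrable_condExp.integrableOn,
      integral_congr_ae (ae_restrict_of_ae (hcenter g hg)),
      setIntegral_condExp hm' (hgZ.integrable (by norm_num)) hC, sub_self]
  · rw [eLpNorm_map_measure _ hZ.aemeasurable] at hgc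
    · exact hgc
    · exact ((measurable_const.indicator hs).sub
        ((l.measurable_apply g).add_const c)).aestronglyMeasurable

end Sufficiency

/-! ### The conjoined conditional covariance operator -/

section CCCO

variable {Ω D D' D'' : Type*} [mΩ : MeasurableSpace Ω] [MeasurableSpace D] [MeasurableSpace D']
  [MeasurableSpace D''] {P : Measure Ω} [IsProbabilityMeasure P]

theorem IsUniversalOn.exists_eLpNorm_lt {k : PosKernel D} {S : Set D} (h : IsUniversalOn k S)
    {Y : Ω → D} (hY : Measurable Y) (hS : P.map Y Sᶜ = 0)
    (hk : Integrable (fun ω => k (Y ω) (Y ω)) P) {F : Set D} (hF : MeasurableSet F)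
    {ε : ℝ≥0∞} (hε : 0 < ε) :
    ∃ f : k.Space,
      eLpNorm (fun ω => (Y ⁻¹' F).indicator (fun _ => (1 : ℝ)) ω - f (Y ω)) 2 P < ε := by
  have hdiag : Measurable fun x => k x x :=
    k.measurable'.comp (f := fun x => (x, x)) (by fun_prop)
  have hprob : IsProbabilityMeasure (P.map Y) := Measure.isProbabilityMeasure_map hY.aemeasurable
  obtain ⟨f, hf⟩ := h (P.map Y) hprob hS
    ((integrable_map_measure hdiag.aestronglyMeasurable hY.aemeasurable).2 hk)
    (F.indicator fun _ => (1 : ℝ)) (memLp_indicator_one hF) ε hε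
  refine ⟨f, ?_⟩
  rw [eLpNorm_map_measure _ hY.aemeasurable] at hf
  · exact hf
  · exact ((measurable_const.indicator hF).sub (k.measurable_apply f)).aestronglyMeasurable

variable {k : PosKernel D} {l : PosKernel D'} {m : PosKernel D''}
  {Y : Ω → D} {Z : Ω → D'} {U : Ω → D''}

/-- `⟪f, Σ_{ŸZ̈|U} g⟫ = E[f(Y, U) (g(Z, U) - E[g(Z, U) | U])]`, the expected conditional covariance
of `f(Y, U)` and `g(Z, U)` given `U`. -/
theorem inner_ccco (hY : Measurable Y) (hZ : Measurable Z) (hU : Measurable U)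
    (hd : DenseModConst P m U)
    (hkm : Integrable (fun ω => k.prod m (Y ω, U ω) (Y ω, U ω)) P)
    (hlm : Integrable (fun ω => l.prod m (Z ω, U ω) (Z ω, U ω)) P)
    (hm : Integrable (fun ω => m (U ω) (U ω)) P)
    (hC : RangeCond P m (l.prod m) U (fun ω => (Z ω, U ω))) (f : (k.prod m).Space)
    {g : (l.prod m).Space} (hg : g ∈ centeredSpace P (l.prod m) fun ω => (Z ω, U ω)) :
    inner ℝ f (ccco P k l m Y Z U hC ⟨g, hg⟩) =
      ∫ ω, f (Y ω, U ω) * (g (Z ω, U ω) - P[fun ω => g (Z ω, U ω) | σ(U)] ω) ∂P := by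
  have hV : Measurable fun ω => (Y ω, U ω) := hY.prodMk hU
  have hW : Measurable fun ω => (Z ω, U ω) := hZ.prodMk hU
  have hf2 := memLp_apply (P := P) hV hkm f
  have hg2 := memLp_apply (P := P) hW hlm g
  obtain ⟨c, hc⟩ := condExp_eq_pinvComp hU hW hm hlm hC hd g
  set h : m.Space := pinvComp (crossCov P m m U U)
    (crossCov P m (l.prod m) U fun ω => (Z ω, U ω)).toLinearMap hC g with hh
  have hh2 := memLp_apply (P := P) hU hm h
  have h1 : inner ℝ f (ccco P k l m Y Z U hC ⟨g, hg⟩) =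
      cov[fun ω => f (Y ω, U ω), fun ω => g (Z ω, U ω); P] -
        cov[fun ω => f (Y ω, U ω), fun ω => h (U ω); P] := by
    rw [← inner_crossCov hV hW hkm hlm, ← inner_crossCov hV hU hkm hm, ← inner_sub_right]
    rfl
  have h2 : cov[fun ω => f (Y ω, U ω), fun ω => h (U ω); P] =
      cov[fun ω => f (Y ω, U ω), P[fun ω => g (Z ω, U ω) | σ(U)]; P] := by
    rw [← covariance_add_const_right (hh2.integrable (by norm_num)) c, covariance, covariance,
      integral_congr_ae hc]
    refine integral_congr_ae ?_
    filter_upwards [hc] with ω hω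
    rw [hω]
  have hcE : MemLp (P[fun ω => g (Z ω, U ω) | σ(U)]) 2 P := hg2.condExp (by norm_num)
  rw [h1, h2, ← covariance_fun_sub_right hf2 hg2 hcE,
    covariance_eq_sub hf2 (memLp_sub_condExp hg2),
    integral_sub_condExp hU.comap_le (hg2.integrable (by norm_num)), mul_zero, sub_zero]
  rfl

/-- With universal product kernels, the conjoined conditional covariance operator vanishes exactly
under conditional independence. -/
theorem condIndepGiven_iff_ccco_eq_zero (hY : Measurable Y) (hZ : Measurable Z) (hU : Measurable U)
    {S : Set (D × D'')} {S' : Set (D' × D'')}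
    (hS : P.map (fun ω => (Y ω, U ω)) Sᶜ = 0) (hS' : P.map (fun ω => (Z ω, U ω)) S'ᶜ = 0)
    (huY : IsUniversalOn (k.prod m) S) (huZ : IsUniversalOn (l.prod m) S')
    (hd : DenseModConst P m U)
    (hkm : Integrable (fun ω => k.prod m (Y ω, U ω) (Y ω, U ω)) P)
    (hlm : Integrable (fun ω => l.prod m (Z ω, U ω) (Z ω, U ω)) P)
    (hm : Integrable (fun ω => m (U ω) (U ω)) P)
    (hC : RangeCond P m (l.prod m) U (fun ω => (Z ω, U ω))) :
    CondIndepGiven P Y Z U ↔ ccco P k l m Y Z U hC = 0 := by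
  have hV : Measurable fun ω => (Y ω, U ω) := hY.prodMk hU
  have hW : Measurable fun ω => (Z ω, U ω) := hZ.prodMk hU
  have hσ : σ(U) ≤ mΩ := hU.comap_le
  have hf2 := fun f => memLp_apply (P := P) hV hkm f
  have hg2 := fun g => memLp_apply (P := P) hW hlm g
  constructor
  · intro h
    refine LinearMap.ext fun ⟨g, hg⟩ => ext_inner_left ℝ fun f => ?_
    rw [inner_ccco hY hZ hU hd hkm hlm hm hC f hg, LinearMap.zero_apply, inner_zero_right]
    exact h.integral_mul_sub_condExp_eq_zero hY hZ hU ((k.prod m).measurable_apply f) (hf2 f)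
      ((l.prod m).measurable_apply g) (hg2 g)
  · intro h0
    have hcenter : ∀ (f : (k.prod m).Space), ∀ g ∈ centeredSpace P (l.prod m) fun ω => (Z ω, U ω),
        ∫ ω, f (Y ω, U ω) * (g (Z ω, U ω) - P[fun ω => g (Z ω, U ω) | σ(U)] ω) ∂P = 0 := by
      intro f g hg
      rw [← inner_ccco hY hZ hU hd hkm hlm hm hC f hg, h0, LinearMap.zero_apply,
        inner_zero_right]
    have hall : ∀ (f : (k.prod m).Space) (g : (l.prod m).Space),
        ∫ ω, g (Z ω, U ω) * (f (Y ω, U ω) - P[fun ω => f (Y ω, U ω) | σ(U)] ω) ∂P = 0 := by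
      intro f g
      have hr := memLp_sub_condExp (m := σ(U)) (hf2 f)
      have hcov : ∀ g : (l.prod m).Space, cov[fun ω => g (Z ω, U ω),
          fun ω => f (Y ω, U ω) - P[fun ω => f (Y ω, U ω) | σ(U)] ω; P] =
          ∫ ω, g (Z ω, U ω) * (f (Y ω, U ω) - P[fun ω => f (Y ω, U ω) | σ(U)] ω) ∂P := fun g => by
        rw [covariance_eq_sub (hg2 g) hr,
          integral_sub_condExp hσ ((hf2 f).integrable (by norm_num)), mul_zero, sub_zero]
        rfl
      rw [← hcov]
      refine covariance_eq_zero_of_centeredSpace hW hlm hr (fun g hg => ?_) g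
      rw [hcov, integral_mul_sub_condExp_comm hσ (hg2 g) (hf2 f)]
      exact hcenter f g hg
    rw [condIndepGiven_iff_setIntegral hY hZ hU]
    intro s t u hs ht hu
    have hsu : MeasurableSet (s ×ˢ u) := hs.prod hu
    have htu : MeasurableSet (t ×ˢ (Set.univ : Set D'')) := ht.prod MeasurableSet.univ
    have hZt := memLp_indicator_one (P := P) (hZ ht)
    have hYs := memLp_indicator_one (P := P) ((hY hs).inter (hU hu))
    rw [← integral_indicator_one_mul ((hY hs).inter (hU hu))]
    refine integral_mul_eq_zero_of_approx hYs (memLp_sub_condExp hZt) fun ε hε => ?_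
    obtain ⟨f, hf⟩ := huY.exists_eLpNorm_lt hV hS hkm hsu hε
    refine ⟨fun ω => f (Y ω, U ω), hf2 f, ?_, hf⟩
    rw [integral_mul_sub_condExp_comm hσ (hf2 f) hZt]
    refine integral_mul_eq_zero_of_approx hZt (memLp_sub_condExp (hf2 f)) fun δ hδ => ?_
    obtain ⟨g, hg⟩ := huZ.exists_eLpNorm_lt hW hS' hlm htu hδ
    refine ⟨fun ω => g (Z ω, U ω), hg2 g, hall f g, ?_⟩
    have hpre : (fun ω => (Z ω, U ω)) ⁻¹' (t ×ˢ (Set.univ : Set D'')) = Z ⁻¹' t := by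
      ext ω; simp
    rwa [hpre] at hg

end CCCO

theorem map_prodMk_compl_univ_prod_support {Ω D D'' : Type*} [MeasurableSpace Ω]
    [MeasurableSpace D] [MeasurableSpace D''] [TopologicalSpace D''] [SecondCountableTopology D'']
    [OpensMeasurableSpace D''] {P : Measure Ω} {Y : Ω → D} {U : Ω → D''} (hY : Measurable Y)
    (hU : Measurable U) :
    P.map (fun ω => (Y ω, U ω)) (Set.univ ×ˢ (P.map U).support)ᶜ = 0 := by
  have hm : MeasurableSet (P.map U).support := Measure.isClosed_support.measurableSet
  rw [Measure.map_apply (hY.prodMk hU) (MeasurableSet.univ.prod hm).compl]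
  have h := Measure.measure_compl_support (μ := P.map U)
  rw [Measure.map_apply hU hm.compl] at h
  refine measure_mono_null (fun ω hω => ?_) h
  simpa using hω

end FSGM

/-! ### Equivalence of the three conditions -/

open FSGM in
theorem theorem2 {p : ℕ} {H : Fin p → Type*}
    [∀ k, NormedAddCommGroup (H k)] [∀ k, InnerProductSpace ℝ (H k)] [∀ k, CompleteSpace (H k)]
    [∀ k, TopologicalSpace.SeparableSpace (H k)]
    [∀ k, MeasurableSpace (H k)] [∀ k, BorelSpace (H k)]
    {Ω : Type*} [MeasurableSpace Ω] (P : Measure Ω) [IsProbabilityMeasure P]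
    -- the random element and the graph
    (X : Ω → ∀ k, H k) (hX : Measurable X)
    (G : SimpleGraph (Fin p)) (hG : IsGraphicalModel P X G)
    (i j : Fin p) (hij : i ≠ j)
    -- kernels for the dimension reduction step, with the second-moment conditions
    (κp : PosKernel (H i × H j))
    (κm : PosKernel (∀ k : {k : Fin p // k ≠ i ∧ k ≠ j}, H k))
    (hκp : Integrable (fun ω => κp (pairVec X i j ω) (pairVec X i j ω)) P)
    (hκm : Integrable (fun ω => κm (restVec X i j ω) (restVec X i j ω)) P)
    -- the regression operator is well defined and has rank `d`
    (hR : RangeCond P κm κp (restVec X i j) (pairVec X i j))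
    (d : ℕ)
    (hfin : FiniteDimensional ℝ
      (LinearMap.range (regressionOp P κm κp (restVec X i j) (pairVec X i j) hR)))
    (hrank : Module.finrank ℝ
      (LinearMap.range (regressionOp P κm κp (restVec X i j) (pairVec X i j) hR)) = d)
    (hdm : DenseModConst P κm (restVec X i j))
    (hdp : DenseModConst P κp (pairVec X i j))
    -- the f-GSIR eigenfunctions and the sufficient predictor
    (f : Fin d → κm.Space) (hf : IsGSIR P κm κp (restVec X i j) (pairVec X i j) f)
    (U : Ω → EuclideanSpace ℝ (Fin d)) (hU : U = predictor f (restVec X i j))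
    -- kernels for the conditional independence step
    (κi : PosKernel (H i)) (κj : PosKernel (H j)) (lam : PosKernel (EuclideanSpace ℝ (Fin d)))
    (hui : IsUniversalOn (κi.prod lam) (Set.univ ×ˢ (P.map U).support))
    (huj : IsUniversalOn (κj.prod lam) (Set.univ ×ˢ (P.map U).support))
    (hdU : DenseModConst P lam U)
    (hmi : Integrable (fun ω => κi.prod lam (X ω i, U ω) (X ω i, U ω)) P)
    (hmj : Integrable (fun ω => κj.prod lam (X ω j, U ω) (X ω j, U ω)) P)
    (hmU : Integrable (fun ω => lam (U ω) (U ω)) P)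
    (hC : RangeCond P lam (κj.prod lam) U (fun ω => (X ω j, U ω))) :
    (¬ G.Adj i j ↔ CondIndepGiven P (fun ω => X ω i) (fun ω => X ω j) U) ∧
    (CondIndepGiven P (fun ω => X ω i) (fun ω => X ω j) U ↔
      ccco P κi κj lam (fun ω => X ω i) (fun ω => X ω j) U hC = 0) := by
  have hXi : Measurable fun ω => X ω i := (measurable_pi_apply i).comp hX
  have hXj : Measurable fun ω => X ω j := (measurable_pi_apply j).comp hX
  have hp : Measurable (pairVec X i j) := hXi.prodMk hXj
  have hm : Measurable (restVec X i j) :=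
    measurable_pi_lambda _ fun k => (measurable_pi_apply k.1).comp hX
  have hUm : Measurable U := by
    rw [hU]
    exact (measurable_predictor f).mono hm.comap_le le_rfl
  refine ⟨(hG i j hij).trans ?_, condIndepGiven_iff_ccco_eq_zero hXi hXj hUm
    (map_prodMk_compl_univ_prod_support hXi hUm) (map_prodMk_compl_univ_prod_support hXj hUm)
    hui huj hdU hmi hmj hmU hC⟩
  have hsuff : ∀ s : Set (H i × H j), MeasurableSet s →
      P[(pairVec X i j ⁻¹' s).indicator (fun _ => (1 : ℝ)) |
        MeasurableSpace.comap U inferInstance] =ᵐ[P]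
      P[(pairVec X i j ⁻¹' s).indicator (fun _ => (1 : ℝ)) |
        MeasurableSpace.comap (restVec X i j) inferInstance] := fun s hs => by
    rw [hU]
    exact hf.condExp_predictor_eq hm hp hκm hκp hR hrank hdm hdp hs
  refine forall₄_congr fun s t hs ht => ?_
  -- all three conditional probabilities are of events about `(X^i, X^j)`
  have hst := hsuff (s ×ˢ t) (hs.prod ht)
  have hsi := hsuff (Prod.fst ⁻¹' s) (measurable_fst hs)
  have htj := hsuff (Prod.snd ⁻¹' t) (measurable_snd ht)
  exact ⟨fun h => hst.trans (h.trans (hsi.mul htj).symm),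
    fun h => hst.symm.trans (h.trans (hsi.mul htj))⟩
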